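/- For $n\in\mathbb N$ let $DISJ_n:\{0,1\}^n\times\{0,1\}^n\to\{0,1\}$, $DISJ_n(x,y)=\bigwedge_{i=1}^n(\neg x_i\vee\neg y_i)$, be the set disjointness function; Alice holds $x$ and Bob holds $y$. A deterministic protocol is a binary tree whose inner nodes are each owned by Alice or Bob; the owner sends a bit depending on the node and the owner's input, which selects the child to move to, and each leaf carries the output (accept or reject). Its cost is the height of the tree, i.e. the worst-case number of bits exchanged. A nondeterministic protocol lets Alice and Bob each first guess a finite string of bits, each guess being private to the player who made it and free of charge, and then run a deterministic protocol in which each player's messages depend on that player's own input and guess. It computes $f$ if, for all $(x,y)$, some pair of guesses leads to acceptance if and only if $f(x,y)=1$. Let $N(f)$ be the least cost of a nondeterministic protocol computing $f$. A Merlin–Arthur protocol for $f$ (with error $1/4$) consists of a guess length $k\ge 0$ and, for each guess $z\in\{0,1\}^k$ (known to both players) and each value of a public source of independent fair random bits, a deterministic protocol, such that (i) if $f(x,y)=1$, then there is a guess $z$ for which $(x,y)$ is accepted with probability at least $3/4$ over the random bits; (ii) if $f(x,y)=0$, then for no guess $z$ is $(x,y)$ accepted with probability larger than $1/4$. Its cost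 is $k$ plus the maximum, over all guesses and all values of the random bits, of the cost of the deterministic protocol. Let $MA(f)$ be the least cost of a Merlin–Arthur protocol for $f$. Then $MA(DISJ_n)=\Omega(\sqrt n)$ while $N(\neg DISJ_n)=O(\log n)$. That is, there is a constant $c>0$ such that $MA(DISJ_n)\ge c\sqrt n$ for all $n\ge 0$, and there is a constant $C>0$ such that $N(\neg DISJ_n)\le C\log n$ for all $n\ge 2$. -/

import Mathlib

noncomputable section

namespace CommComplexity

/-- A deterministic two-party protocol: a binary tree in which every inner node belongs to the
player who sends the next bit (which depends on that player's input and, through the position in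
the tree, on the bits exchanged so far), and every leaf carries the common output
(`true` means that the protocol accepts). -/
inductive DetProtocol (X Y : Type) : Type
  | output (b : Bool) : DetProtocol X Y
  | alice (msg : X → Bool) (next : Bool → DetProtocol X Y) : DetProtocol X Y
  | bob (msg : Y → Bool) (next : Bool → DetProtocol X Y) : DetProtocol X Y

namespace DetProtocol

variable {X Y : Type}

/-- The output of a protocol on the input `(x, y)`. -/
def eval : DetProtocol X Y → X → Y → Bool
  | output b, _, _ => b
  | alice msg next, x, y => (next (msg x)).eval x y
  | bob msg next, x, y => (next (msg y)).eval x y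

/-- The worst case number of bits exchanged: the height of the tree. -/
def cost : DetProtocol X Y → ℕ
  | output _ => 0
  | alice _ next => 1 + max (next false).cost (next true).cost
  | bob _ next => 1 + max (next false).cost (next true).cost

/-- Every function with a finite input set for Alice is computed by some protocol. -/
theorem exists_eval_eq [Finite X] (f : X → Y → Bool) :
    ∃ P : DetProtocol X Y, ∀ x y, P.eval x y = f x y := by
  classical
  have key : ∀ l : List X, ∃ P : DetProtocol X Y, ∀ x ∈ l, ∀ y, P.eval x y = f x y := by
    intro l
    induction l with
    | nil => exact ⟨output true, by simp⟩
    | cons a l ih =>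
      obtain ⟨P, hP⟩ := ih
      refine ⟨alice (fun x => decide (x = a)) (fun b => bif b then bob (f a) output else P), ?_⟩
      intro x hx y
      by_cases h : x = a
      · simp [eval, h]
      · have hx' : x ∈ l := by simpa [h] using hx
        simp [eval, h, hP x hx' y]
  cases nonempty_fintype X
  obtain ⟨P, hP⟩ := key Finset.univ.toList
  exact ⟨P, fun x y => hP x (by simp) y⟩

end DetProtocol

/-- A nondeterministic protocol: Alice privately guesses `aliceBits` bits and Bob privately guesses
`bobBits` bits, and then they run a deterministic protocol in which the messages of each player
depend on the own input and the own guess. Guessing is free of charge. -/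
structure NondetProtocol (X Y : Type) : Type where
  aliceBits : ℕ
  bobBits : ℕ
  run : DetProtocol (X × (Fin aliceBits → Bool)) (Y × (Fin bobBits → Bool))

namespace NondetProtocol

variable {X Y : Type}

/-- An input is accepted if at least one computation accepts. -/
def Accepts (P : NondetProtocol X Y) (x : X) (y : Y) : Prop :=
  ∃ (u : Fin P.aliceBits → Bool) (v : Fin P.bobBits → Bool), P.run.eval (x, u) (y, v) = true

/-- The protocol computes `f` if it accepts exactly the inputs in `f⁻¹(1)`. -/
def Computes (P : NondetProtocol X Y) (f : X → Y → Bool) : Prop :=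
  ∀ x y, P.Accepts x y ↔ f x y = true

/-- The number of bits exchanged in the worst case. -/
def cost (P : NondetProtocol X Y) : ℕ := P.run.cost

end NondetProtocol

/-- The nondeterministic communication complexity `N(f)`: the cost of an optimal nondeterministic
protocol computing `f`. -/
def nondetComplexity {X Y : Type} (f : X → Y → Bool) : ℕ :=
  sInf {c | ∃ P : NondetProtocol X Y, P.Computes f ∧ P.cost = c}

/-- The minimum in `nondetComplexity` runs over a nonempty set. -/
theorem nondetComplexity_set_nonempty {X Y : Type} [Finite X] (f : X → Y → Bool) :
    {c | ∃ P : NondetProtocol X Y, P.Computes f ∧ P.cost = c}.Nonempty := by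
  obtain ⟨P, hP⟩ := DetProtocol.exists_eval_eq
    (fun (x : X × (Fin 0 → Bool)) (y : Y × (Fin 0 → Bool)) => f x.1 y.1)
  exact ⟨_, ⟨0, 0, P⟩, fun x y => by simp [NondetProtocol.Accepts, hP], rfl⟩

/-- The law of an infinite sequence of independent fair coin tosses. -/
def coinMeasure : MeasureTheory.Measure (ℕ → Bool) :=
  MeasureTheory.Measure.infinitePi fun _ : ℕ => (PMF.uniformOfFintype Bool).toMeasure

instance : MeasureTheory.IsProbabilityMeasure coinMeasure := by
  unfold coinMeasure
  infer_instance

/-- A (public coin) Merlin Arthur protocol: a guess (proof) `z` of `guessBits` bits is made that is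
known to both players, and then they run a randomized protocol, that is, a deterministic protocol
for each value `ω` of the public random bits. -/
structure MAProtocol (X Y : Type) : Type where
  guessBits : ℕ
  run : (Fin guessBits → Bool) → (ℕ → Bool) → DetProtocol X Y
  measurableSet_accept : ∀ z x y, MeasurableSet {ω | (run z ω).eval x y = true}

namespace MAProtocol

variable {X Y : Type}

/-- The probability over the public coins that `(x, y)` is accepted with the guess `z`. -/
def acceptProb (P : MAProtocol X Y) (z : Fin P.guessBits → Bool) (x : X) (y : Y) : ℝ :=
  coinMeasure.real {ω | (P.run z ω).eval x y = true}

/-- The protocol computes `f` with error `ε`: on each 1-input some guess is accepted with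
probability at least `1 - ε`, on each 0-input no guess is accepted with probability larger
than `ε`. -/
def Computes (P : MAProtocol X Y) (ε : ℝ) (f : X → Y → Bool) : Prop :=
  (∀ x y, f x y = true → ∃ z, 1 - ε ≤ P.acceptProb z x y) ∧
  (∀ x y, f x y = false → ¬ ∃ z, ε < P.acceptProb z x y)

/-- The length of the guess plus the communication, maximized over the guesses and the coin
tosses, is at most `c`. -/
def CostLE (P : MAProtocol X Y) (c : ℕ) : Prop :=
  ∀ z ω, P.guessBits + (P.run z ω).cost ≤ c

end MAProtocol

/-- The Merlin Arthur communication complexity `MA_ε(f)` with error `ε`: the cost of an optimal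
Merlin Arthur protocol for `f` with error `ε`. -/
def maComplexityWithError {X Y : Type} (ε : ℝ) (f : X → Y → Bool) : ℕ :=
  sInf {c | ∃ P : MAProtocol X Y, P.Computes ε f ∧ P.CostLE c}

/-- The minimum in `maComplexityWithError` runs over a nonempty set. -/
theorem maComplexityWithError_set_nonempty {X Y : Type} [Finite X] {ε : ℝ} (hε : 0 ≤ ε)
    (f : X → Y → Bool) :
    {c | ∃ P : MAProtocol X Y, P.Computes ε f ∧ P.CostLE c}.Nonempty := by
  obtain ⟨P, hP⟩ := DetProtocol.exists_eval_eq f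
  refine ⟨P.cost, ⟨0, fun _ _ => P, fun _ _ _ => MeasurableSet.const _⟩, ⟨?_, ?_⟩, ?_⟩
  · intro x y h
    refine ⟨Fin.elim0, ?_⟩
    simp [MAProtocol.acceptProb, hP, h, hε]
  · rintro x y h ⟨z, hz⟩
    simp only [MAProtocol.acceptProb, hP, h] at hz
    simp at hz
    linarith
  · intro z ω
    simp

/-- `MA(f)`, where the error is `1/4`. -/
def maComplexity {X Y : Type} (f : X → Y → Bool) : ℕ :=
  maComplexityWithError (1 / 4) f

/-- Set disjointness `DISJ(x, y) = ⋀ᵢ (¬ xᵢ ∨ ¬ yᵢ)` on `{0,1}ⁿ × {0,1}ⁿ`. -/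
def disj (n : ℕ) (x y : Fin n → Bool) : Bool :=
  decide (∀ i, x i = false ∨ y i = false)

end CommComplexity

end

/-!
The upper bound for `¬ DISJ` is the protocol in which Alice guesses a common element of the two sets
and sends its index.

The lower bound rests on a corruption bound for rectangles, `hitSum_rect_ge`. Consider random
disjoint inputs: each coordinate is given to Alice or to Bob by a fair coin (the set `d`), and each
player takes a random subset of the own coordinates. Adding a random coordinate `i` to both
inputs yields random intersecting inputs. The claim is that a rectangle of mass `μ` on the disjoint
inputs has mass at least `μ / 12 - 2 exp (-n / 252)` on the intersecting ones. Given `d`, the two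
inputs are independent and uniform on cubes, and a side of the rectangle cuts out a subset of such a
cube. Call a coordinate biased if one of its two values is more than twice as frequent as the other
in that subset. A Chernoff bound (`sum_le_exp_card_biased`) shows that a subset with `b` biased
coordinates has density at most `exp (-b / 18)`; so, if the rectangle is not exponentially small
given `d`, then most coordinates are unbiased. Now fix `i` and the division of the other
coordinates, and let `f₀, f₁` and `g₀, g₁` be the masses of the two sides with the value at `i` fixed. The
intersecting inputs have mass `f₁ * g₁`, the disjoint ones `(f₀ + f₁) / 2 * g₀` if `i` belongs to
Alice and `f₀ * (g₀ + g₁) / 2` if it belongs to Bob. These are comparable if both sides are unbiased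
at `i`, and `mul_le_of_unbiased` charges the remaining cases to the few biased coordinates.

Corruption is linear, so it passes to nonnegative combinations of rectangles (`IsRectSum`). For a
Merlin–Arthur protocol of cost `c` with `k` guessed bits, the acceptance probability `p_z` for the
guess `z` is a combination of rectangles of weight at most `2 ^ c`, and therefore
`∑_z p_z ^ t` is one of weight at most `2 ^ (k + c * t)`. This sum is at least `(3 / 4) ^ t` on
disjoint inputs and at most `2 ^ k * (1 / 4) ^ t` on intersecting ones. Taking powers thus replaces
the amplification by repetition, and `t = k + 4` makes the gap exceed the factor `12`. Hence
`2 ^ (k + c * t)` is exponential in `n`, and `n = O(c ^ 2)`.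
-/

namespace CommComplexity

open Finset

/-! ### Combinations of rectangles -/

/-- `F` is a combination, with nonnegative coefficients of sum at most `m`, of fractional
rectangles, that is, of functions `(x, y) ↦ a x * b y` where `a` and `b` have values in `[0, 1]`.
Fractional rectangles are closed under products, and no decidability is needed to speak of them. -/
def IsRectSum {X Y : Type} (m : ℝ) (F : X → Y → ℝ) : Prop :=
  ∃ (ι : Type) (_ : Fintype ι) (w : ι → ℝ) (a : ι → X → ℝ) (b : ι → Y → ℝ),
    (∀ i, 0 ≤ w i) ∧ ∑ i, w i ≤ m ∧ (∀ i x, a i x ∈ Set.Icc (0 : ℝ) 1) ∧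
      (∀ i y, b i y ∈ Set.Icc (0 : ℝ) 1) ∧ ∀ x y, F x y = ∑ i, w i * (a i x * b i y)

namespace IsRectSum

variable {X Y : Type} {m m' : ℝ} {F G : X → Y → ℝ}

theorem of_rect {a : X → ℝ} {b : Y → ℝ} (ha : ∀ x, a x ∈ Set.Icc (0 : ℝ) 1)
    (hb : ∀ y, b y ∈ Set.Icc (0 : ℝ) 1) : IsRectSum 1 fun x y => a x * b y :=
  ⟨Unit, inferInstance, fun _ => 1, fun _ => a, fun _ => b, by simp, by simp, fun _ => ha,
    fun _ => hb, by simp⟩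

theorem const_one : IsRectSum 1 fun (_ : X) (_ : Y) => (1 : ℝ) := by
  simpa using of_rect (X := X) (Y := Y) (a := fun _ => 1) (b := fun _ => 1) (by simp) (by simp)

theorem zero (X Y : Type) : IsRectSum 0 fun (_ : X) (_ : Y) => (0 : ℝ) :=
  ⟨Empty, inferInstance, fun _ => 0, fun _ _ => 0, fun _ _ => 0, by simp, by simp, by simp,
    by simp, by simp⟩

theorem mono (h : IsRectSum m F) (hm : m ≤ m') : IsRectSum m' F := by
  obtain ⟨ι, _, w, a, b, hw, hs, hab⟩ := h
  exact ⟨ι, _, w, a, b, hw, hs.trans hm, hab⟩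

theorem add (hF : IsRectSum m F) (hG : IsRectSum m' G) :
    IsRectSum (m + m') fun x y => F x y + G x y := by
  obtain ⟨ι, _, w, a, b, hw, hs, ha, hb, h⟩ := hF
  obtain ⟨ι', _, w', a', b', hw', hs', ha', hb', h'⟩ := hG
  refine ⟨ι ⊕ ι', inferInstance, Sum.elim w w', Sum.elim a a', Sum.elim b b', ?_, ?_, ?_, ?_, ?_⟩
  · rintro (i | i) <;> simp [hw, hw']
  · simpa using add_le_add hs hs'
  · rintro (i | i) x <;> simp only [Sum.elim_inl, Sum.elim_inr, ha, ha']
  · rintro (i | i) y <;> simp only [Sum.elim_inl, Sum.elim_inr, hb, hb']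
  · intro x y
    simp [h, h']

theorem smul {c : ℝ} (hc : 0 ≤ c) (hF : IsRectSum m F) :
    IsRectSum (c * m) fun x y => c * F x y := by
  obtain ⟨ι, _, w, a, b, hw, hs, ha, hb, h⟩ := hF
  refine ⟨ι, inferInstance, fun i => c * w i, a, b, fun i => mul_nonneg hc (hw i), ?_, ha, hb, ?_⟩
  · rw [← mul_sum]
    exact mul_le_mul_of_nonneg_left hs hc
  · intro x y
    simp [h, mul_sum, mul_assoc]

theorem mul (hF : IsRectSum m F) (hG : IsRectSum m' G) :
    IsRectSum (m * m') fun x y => F x y * G x y := by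
  obtain ⟨ι, _, w, a, b, hw, hs, ha, hb, h⟩ := hF
  obtain ⟨ι', _, w', a', b', hw', hs', ha', hb', h'⟩ := hG
  refine ⟨ι × ι', inferInstance, fun p => w p.1 * w' p.2, fun p x => a p.1 x * a' p.2 x,
    fun p y => b p.1 y * b' p.2 y, fun p => mul_nonneg (hw _) (hw' _), ?_, ?_, ?_, ?_⟩
  · rw [Fintype.sum_prod_type, ← Fintype.sum_mul_sum]
    exact mul_le_mul hs hs' (sum_nonneg fun i _ => hw' i)
      ((sum_nonneg fun i _ => hw i).trans hs)
  · exact fun p x => unitInterval.mul_mem (ha _ _) (ha' _ _)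
  · exact fun p y => unitInterval.mul_mem (hb _ _) (hb' _ _)
  · intro x y
    simp only [h, h']
    rw [Fintype.sum_mul_sum, Fintype.sum_prod_type]
    exact sum_congr rfl fun i _ => sum_congr rfl fun j _ => by ring

theorem pow (hF : IsRectSum m F) (t : ℕ) : IsRectSum (m ^ t) fun x y => F x y ^ t := by
  induction t with
  | zero => simpa using const_one
  | succ t ih => simpa [pow_succ] using ih.mul hF

theorem sum {κ : Type*} (s : Finset κ) {m : κ → ℝ} {F : κ → X → Y → ℝ}
    (h : ∀ k ∈ s, IsRectSum (m k) (F k)) :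
    IsRectSum (∑ k ∈ s, m k) fun x y => ∑ k ∈ s, F k x y := by
  classical
  induction s using Finset.induction_on with
  | empty => simpa using zero X Y
  | insert k s hk ih =>
    simp only [sum_insert hk]
    exact (h k (mem_insert_self k s)).add (ih fun j hj => h j (mem_insert_of_mem hj))

end IsRectSum

/-- The accepting leaves of a protocol tree correspond to disjoint rectangles. -/
theorem DetProtocol.isRectSum {X Y : Type} (P : DetProtocol X Y) :
    IsRectSum (2 ^ P.cost) fun x y => if P.eval x y = true then (1 : ℝ) else 0 := by
  -- A player's bit splits the indicator into two parts, each cut down to a strip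
  have key : ∀ {c₀ c₁ : ℕ} {u : X → Y → Bool} {F : Bool → X → Y → ℝ},
      (∀ β : Bool, IsRectSum 1 fun x y => if u x y = β then (1 : ℝ) else 0) →
      IsRectSum (2 ^ c₀) (F false) → IsRectSum (2 ^ c₁) (F true) →
      IsRectSum (2 ^ (1 + max c₀ c₁)) fun x y => F (u x y) x y := by
    intro c₀ c₁ u F hu h₀ h₁
    have h := ((hu false).mul h₀).add ((hu true).mul h₁)
    have e : (fun x y => F (u x y) x y) = fun x y =>
        (if u x y = false then (1 : ℝ) else 0) * F false x y +
          (if u x y = true then (1 : ℝ) else 0) * F true x y := by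
      funext x y
      cases hxy : u x y <;> simp
    rw [e]
    refine h.mono ?_
    have e₀ : (2 : ℝ) ^ c₀ ≤ 2 ^ max c₀ c₁ := pow_le_pow_right₀ (by norm_num) (le_max_left _ _)
    have e₁ : (2 : ℝ) ^ c₁ ≤ 2 ^ max c₀ c₁ := pow_le_pow_right₀ (by norm_num) (le_max_right _ _)
    rw [pow_add]
    linarith
  induction P with
  | output b =>
    cases b
    · simpa [eval, cost] using (IsRectSum.zero X Y).mono zero_le_one
    · simpa [eval, cost] using IsRectSum.const_one
  | alice msg next ih =>
    refine key (u := fun x _ => msg x)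
      (F := fun β x y => if (next β).eval x y = true then 1 else 0) ?_ (ih false) (ih true)
    intro β
    simpa using IsRectSum.of_rect (Y := Y) (a := fun x => if msg x = β then (1 : ℝ) else 0)
      (b := fun _ => 1) (fun x => by split_ifs <;> simp) (by simp)
  | bob msg next ih =>
    refine key (u := fun _ y => msg y)
      (F := fun β x y => if (next β).eval x y = true then 1 else 0) ?_ (ih false) (ih true)
    intro β
    simpa using IsRectSum.of_rect (X := X) (a := fun _ => 1)
      (b := fun y => if msg y = β then (1 : ℝ) else 0) (by simp) (fun x => by split_ifs <;> simp)

/-- The acceptance probability is an average of indicators of deterministic protocols. As there are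
only finitely many inputs, this average is a finite sum, over the possible sets of accepted
inputs. -/
theorem MAProtocol.isRectSum_acceptProb {X Y : Type} [Finite X] [Finite Y] (P : MAProtocol X Y)
    (z : Fin P.guessBits → Bool) {c : ℕ} (hc : ∀ ω, (P.run z ω).cost ≤ c) :
    IsRectSum (2 ^ c) (P.acceptProb z) := by
  classical
  cases nonempty_fintype X
  cases nonempty_fintype Y
  let acc : (ℕ → Bool) → X → Y → Bool := fun ω => (P.run z ω).eval
  have hmeas : ∀ E : X → Y → Bool, MeasurableSet {ω | acc ω = E} := by
    intro E
    have : {ω | acc ω = E} = ⋂ x, ⋂ y, {ω | acc ω x y = E x y} := by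
      ext ω
      simp [funext_iff]
    rw [this]
    refine MeasurableSet.iInter fun x => MeasurableSet.iInter fun y => ?_
    cases E x y
    · have h := (P.measurableSet_accept z x y).compl
      simpa [Set.compl_def, acc] using h
    · exact P.measurableSet_accept z x y
  have hdisj : ∀ s : Set (X → Y → Bool),
      s.PairwiseDisjoint fun E => {ω | acc ω = E} := by
    intro s E _ E' _ hne
    refine Set.disjoint_left.2 fun ω h h' => hne ?_
    exact h.symm.trans h'
  let p : (X → Y → Bool) → ℝ := fun E => coinMeasure.real {ω | acc ω = E}
  have hp : ∀ s : Finset (X → Y → Bool),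
      coinMeasure.real {ω | acc ω ∈ s} = ∑ E ∈ s, p E := by
    intro s
    rw [← MeasureTheory.measureReal_biUnion_finset (hdisj _) fun E _ => hmeas E]
    congr 1
    ext ω
    simp
  have hsum : ∑ E, p E = 1 := by
    rw [← hp]
    simp
  have hF : P.acceptProb z = fun x y => ∑ E, p E * if E x y = true then (1 : ℝ) else 0 := by
    funext x y
    have : {ω | (P.run z ω).eval x y = true} = {ω | acc ω ∈ univ.filter fun E => E x y = true} := by
      ext ω
      simp [acc]
    rw [MAProtocol.acceptProb, this, hp, sum_filter]
    simp
  rw [hF]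
  have hone : ∑ E, p E * (2 : ℝ) ^ c = 2 ^ c := by
    rw [← sum_mul, hsum, one_mul]
  rw [← hone]
  refine IsRectSum.sum univ fun E _ => ?_
  by_cases hE : ∃ ω, acc ω = E
  · obtain ⟨ω, rfl⟩ := hE
    refine IsRectSum.smul MeasureTheory.measureReal_nonneg ?_
    exact (P.run z ω).isRectSum.mono (pow_le_pow_right₀ (by norm_num) (hc ω))
  · have h0 : p E = 0 := by
      have : {ω | acc ω = E} = ∅ := by
        ext ω
        simpa using fun h => hE ⟨ω, h⟩
      simp [p, this]
    simpa [h0] using IsRectSum.zero X Y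

/-! ### Biased coordinates of subsets of the cube -/

/-- The part of the weight `a` that lies on the points with `i`-th coordinate `β`. -/
noncomputable def halfSum {n : ℕ} (a : (Fin n → Bool) → ℝ) (i : Fin n) (β : Bool) : ℝ :=
  ∑ x, if x i = β then a x else 0

/-- The coordinates on which one of the two values carries more than twice the weight of the
other one. -/
noncomputable def biased {n : ℕ} (a : (Fin n → Bool) → ℝ) : Finset (Fin n) :=
  univ.filter fun i =>
    2 * halfSum a i false < halfSum a i true ∨ 2 * halfSum a i true < halfSum a i false

theorem halfSum_add_halfSum {n : ℕ} (a : (Fin n → Bool) → ℝ) (i : Fin n) :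
    halfSum a i false + halfSum a i true = ∑ x, a x := by
  rw [halfSum, halfSum, ← sum_add_distrib]
  refine sum_congr rfl fun x _ => ?_
  cases x i <;> simp

/-- The exponential moment of a sum of signs: each of the `#s` independent signs contributes the
factor `cosh (1 / 3) ≤ exp (1 / 18)`. -/
theorem sum_exp_signs_le {n : ℕ} (s : Finset (Fin n)) (e : Fin n → ℝ) (he : ∀ i, |e i| = 1) :
    ∑ x : Fin n → Bool, Real.exp (∑ i ∈ s, (if x i = true then e i else -e i) / 3) ≤
      2 ^ n * Real.exp (#s / 18) := by
  have h1 : ∀ x : Fin n → Bool, Real.exp (∑ i ∈ s, (if x i = true then e i else -e i) / 3) =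
      ∏ i, if i ∈ s then Real.exp ((if x i = true then e i else -e i) / 3) else 1 := by
    intro x
    rw [Real.exp_sum, prod_ite_mem, univ_inter]
  have h2 := Fintype.prod_sum fun (i : Fin n) (β : Bool) =>
    if i ∈ s then Real.exp ((if β = true then e i else -e i) / 3) else (1 : ℝ)
  simp only [h1]
  rw [← h2]
  have h3 : ∀ i ∈ (univ : Finset (Fin n)),
      (∑ β : Bool, if i ∈ s then Real.exp ((if β = true then e i else -e i) / 3) else (1 : ℝ)) ≤
        2 * if i ∈ s then Real.exp (1 / 18) else 1 := by
    intro i _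
    by_cases hi : i ∈ s
    · have hc := Real.cosh_le_exp_half_sq (e i / 3)
      have hsq : (e i / 3) ^ 2 / 2 = 1 / 18 := by
        have : e i ^ 2 = 1 := by rw [← sq_abs, he, one_pow]
        rw [div_pow, this]
        norm_num
      rw [hsq, Real.cosh_eq] at hc
      simp only [hi, if_true, Fintype.sum_bool, Bool.false_eq_true, if_false, neg_div]
      linarith
    · simp [hi]
  refine (prod_le_prod (fun i _ => sum_nonneg fun β _ => ?_) h3).trans (le_of_eq ?_)
  · split_ifs <;> positivity
  · rw [prod_mul_distrib, prod_const, card_univ, Fintype.card_fin, prod_ite_mem, univ_inter,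
      prod_const, ← Real.exp_nat_mul]
    congr 2
    ring

/-- A large subset of the cube has few biased coordinates. This is a Chernoff bound: the average
over the subset of the number of biased coordinates on which a point has the prevalent value is
much larger than for a random point of the cube. -/
theorem sum_le_exp_card_biased {n : ℕ} {a : (Fin n → Bool) → ℝ}
    (ha : ∀ x, a x ∈ Set.Icc (0 : ℝ) 1) :
    ∑ x, a x ≤ 2 ^ n * Real.exp (-(#(biased a) / 18)) := by
  set b : ℝ := (#(biased a) : ℝ) with hb
  have hnn : ∀ i β, 0 ≤ halfSum a i β := fun i β =>
    sum_nonneg fun x _ => by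
      split_ifs
      · exact (ha x).1
      · exact le_rfl
  -- `e i` is the sign of the prevalent value
  let e : Fin n → ℝ := fun i => if halfSum a i false < halfSum a i true then 1 else -1
  let T : (Fin n → Bool) → ℝ := fun x => ∑ i ∈ biased a, (if x i = true then e i else -e i) / 3
  have hcoord : ∀ i ∈ biased a,
      (∑ x, a x) / 9 ≤ ∑ x, a x * ((if x i = true then e i else -e i) / 3) := by
    intro i hi
    have h1 : ∑ x, a x * ((if x i = true then e i else -e i) / 3) =
        e i / 3 * (halfSum a i true - halfSum a i false) := by
      rw [halfSum, halfSum, ← sum_sub_distrib, mul_sum]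
      refine sum_congr rfl fun x _ => ?_
      cases x i <;> simp <;> ring
    rw [h1, ← halfSum_add_halfSum a i]
    have h0 := hnn i false
    have h0' := hnn i true
    simp only [biased, mem_filter, mem_univ, true_and] at hi
    simp only [e]
    split_ifs with hlt <;> rcases hi with hi | hi <;> linarith
  have hT : b / 9 * ∑ x, a x ≤ ∑ x, a x * T x := by
    simp only [T, mul_sum]
    rw [sum_comm]
    refine le_trans (le_of_eq ?_) (sum_le_sum hcoord)
    rw [sum_const, nsmul_eq_mul, ← hb, ← mul_sum]
    ring
  have hlow : Real.exp (b / 9) * ∑ x, a x ≤ ∑ x, a x * Real.exp (T x) := by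
    have h1 : ∀ x ∈ (univ : Finset (Fin n → Bool)),
        Real.exp (b / 9) * (a x * (T x - b / 9 + 1)) ≤ a x * Real.exp (T x) := by
      intro x _
      have h := Real.add_one_le_exp (T x - b / 9)
      have h2 : Real.exp (T x) = Real.exp (b / 9) * Real.exp (T x - b / 9) := by
        rw [← Real.exp_add]
        ring_nf
      rw [h2, mul_left_comm (a x)]
      exact mul_le_mul_of_nonneg_left (mul_le_mul_of_nonneg_left h (ha x).1) (Real.exp_nonneg _)
    refine le_trans ?_ (sum_le_sum h1)
    rw [← mul_sum]
    refine mul_le_mul_of_nonneg_left ?_ (Real.exp_nonneg _)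
    have h3 : ∑ x, a x * (T x - b / 9 + 1) = ∑ x, a x * T x - b / 9 * ∑ x, a x + ∑ x, a x := by
      rw [mul_sum, ← sum_sub_distrib, ← sum_add_distrib]
      exact sum_congr rfl fun x _ => by ring
    linarith
  have hupp : ∑ x, a x * Real.exp (T x) ≤ 2 ^ n * Real.exp (b / 18) := by
    refine le_trans (sum_le_sum fun x _ => ?_)
      (sum_exp_signs_le (biased a) e fun i => ?_)
    · exact mul_le_of_le_one_left (Real.exp_nonneg _) (ha x).2
    · simp only [e]
      split_ifs <;> simp
  have h := hlow.trans hupp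
  have h4 : Real.exp (b / 18) = Real.exp (b / 9) * Real.exp (-(b / 18)) := by
    rw [← Real.exp_add]
    ring_nf
  rw [h4, mul_left_comm] at h
  exact le_of_mul_le_mul_left h (Real.exp_pos _)

/-! ### Corruption of rectangles -/

/-- The points of `x` that belong to `d`. -/
def mask {n : ℕ} (d x : Fin n → Bool) : Fin n → Bool := fun i => x i && d i

/-- The complement of `d`. -/
def compl {n : ℕ} (d : Fin n → Bool) : Fin n → Bool := fun i => !d i

/-- The involution on `{0,1}ⁿ` that changes the `i`-th coordinate. -/
def flip {n : ℕ} (i : Fin n) : (Fin n → Bool) ≃ (Fin n → Bool) :=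
  Function.Involutive.toPerm (fun d => Function.update d i (!d i)) fun d => by simp

theorem flip_apply {n : ℕ} (i : Fin n) (d : Fin n → Bool) :
    flip i d = Function.update d i (!d i) := rfl

@[simp]
theorem flip_flip {n : ℕ} (i : Fin n) (d : Fin n → Bool) : flip i (flip i d) = d := by
  simp [flip_apply]

@[simp]
theorem flip_same {n : ℕ} (i : Fin n) (d : Fin n → Bool) : flip i d i = !d i := by
  simp [flip_apply]

theorem compl_flip {n : ℕ} (i : Fin n) (d : Fin n → Bool) :
    compl (flip i d) = flip i (compl d) := by
  funext j
  by_cases h : j = i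
  · subst h
    simp [compl]
  · simp [compl, flip_apply, h]

/-- The sum of `a` over the subsets of `d`, each counted as often as it is cut out of `d`. -/
noncomputable def maskSum {n : ℕ} (a : (Fin n → Bool) → ℝ) (d : Fin n → Bool) : ℝ :=
  ∑ x, a (mask d x)

/-- The sum `maskSum` with the `i`-th coordinate of the argument of `a` fixed to be `β`. -/
noncomputable def fixSum {n : ℕ} (a : (Fin n → Bool) → ℝ) (i : Fin n) (β : Bool)
    (d : Fin n → Bool) : ℝ :=
  ∑ x, a (Function.update (mask d x) i β)

/-- The biased coordinates of the weight that `a` puts on the subsets of `d`. They all belong to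
`d`, as the coordinates outside `d` do not affect this weight. -/
noncomputable def maskBiased {n : ℕ} (a : (Fin n → Bool) → ℝ) (d : Fin n → Bool) :
    Finset (Fin n) :=
  biased fun x => a (mask d x)

section

variable {n : ℕ} (a : (Fin n → Bool) → ℝ) (i : Fin n) (d : Fin n → Bool)

theorem fixSum_flip (β : Bool) : fixSum a i β (flip i d) = fixSum a i β d := by
  refine sum_congr rfl fun x _ => congrArg a ?_
  funext j
  by_cases h : j = i
  · subst h
    simp
  · simp [mask, flip_apply, h]

theorem maskSum_of_false (h : d i = false) : maskSum a d = fixSum a i false d := by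
  refine sum_congr rfl fun x _ => congrArg a ?_
  rw [eq_comm, Function.update_eq_self_iff]
  simp [mask, h]

theorem fixSum_eq_two_mul_halfSum (h : d i = true) (β : Bool) :
    fixSum a i β d = 2 * halfSum (fun x => a (mask d x)) i β := by
  have h1 : ∀ x, a (Function.update (mask d x) i β) =
      (if x i = β then a (mask d x) else 0) +
        if flip i x i = β then a (mask d (flip i x)) else 0 := by
    intro x
    by_cases hx : x i = β
    · have e : Function.update (mask d x) i β = mask d x := by
        rw [Function.update_eq_self_iff]
        simp [mask, h, hx]
      rw [e]
      simp [hx]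
    · have hx' : (!x i) = β := by
        cases hxi : x i <;> cases β <;> simp_all
      have e : Function.update (mask d x) i β = mask d (flip i x) := by
        funext j
        by_cases hj : j = i
        · subst hj
          simp [mask, h, hx']
        · simp [mask, flip_apply, hj]
      rw [e]
      simp [hx, hx']
  rw [fixSum, sum_congr rfl fun x _ => h1 x, sum_add_distrib, two_mul, halfSum]
  congr 1
  exact Equiv.sum_comp (flip i) fun x => if x i = β then a (mask d x) else 0

theorem maskSum_of_true (h : d i = true) :
    maskSum a d = (fixSum a i false d + fixSum a i true d) / 2 := by
  rw [fixSum_eq_two_mul_halfSum a i d h, fixSum_eq_two_mul_halfSum a i d h, ← mul_add,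
    halfSum_add_halfSum, mul_div_cancel_left₀ _ two_ne_zero, maskSum]

theorem mem_maskBiased_iff (h : d i = true) : i ∈ maskBiased a d ↔
    2 * fixSum a i false d < fixSum a i true d ∨ 2 * fixSum a i true d < fixSum a i false d := by
  rw [fixSum_eq_two_mul_halfSum a i d h, fixSum_eq_two_mul_halfSum a i d h]
  simp only [maskBiased, biased, mem_filter, mem_univ, true_and]
  refine or_congr ?_ ?_ <;> constructor <;> intro h <;> linarith

end

/-- The comparison at one coordinate, with the other coordinates divided: `f₀, f₁` and `g₀, g₁` are
the masses of the two sides of a rectangle with the value of the coordinate fixed, and `p`, `q` say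
that the coordinate is biased for the owner. If `p` and `q` fail, then the left side is at most
`f₀ * g₀ / 4`; otherwise the coefficient `7 / 12` makes it nonpositive. -/
theorem mul_le_of_unbiased {f₀ f₁ g₀ g₁ : ℝ} (hf₀ : 0 ≤ f₀) (hf₁ : 0 ≤ f₁) (hg₀ : 0 ≤ g₀)
    (hg₁ : 0 ≤ g₁) {p q : Prop} [Decidable p] [Decidable q]
    (hp : p ↔ 2 * f₀ < f₁ ∨ 2 * f₁ < f₀) (hq : q ↔ 2 * g₀ < g₁ ∨ 2 * g₁ < g₀) :
    (f₀ + f₁) / 2 * g₀ * (1 / 12 - 7 / 12 * if p then 1 else 0) +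
      f₀ * ((g₀ + g₁) / 2) * (1 / 12 - 7 / 12 * if q then 1 else 0) ≤ f₁ * g₁ := by
  have h00 := mul_nonneg hf₀ hg₀
  have h01 := mul_nonneg hf₀ hg₁
  have h10 := mul_nonneg hf₁ hg₀
  have h11 := mul_nonneg hf₁ hg₁
  by_cases h1 : p <;> by_cases h2 : q <;> simp only [h1, h2, if_true, if_false]
  · nlinarith
  · rw [hq, not_or, not_lt, not_lt] at h2
    nlinarith [mul_le_mul_of_nonneg_left h2.1 hf₀]
  · rw [hp, not_or, not_lt, not_lt] at h1
    nlinarith [mul_le_mul_of_nonneg_right h1.1 hg₀]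
  · rw [hp, not_or, not_lt, not_lt] at h1
    rw [hq, not_or, not_lt, not_lt] at h2
    nlinarith [mul_le_mul_of_nonneg_left h2.1 hf₀, mul_le_mul_of_nonneg_right h1.1 hg₀,
      mul_le_mul h1.2 h2.2 hg₀ (by linarith)]

/-- The number of coordinates on which the inputs of their owner are biased, if `d` is the set of
coordinates of Alice. -/
noncomputable def badCount {n : ℕ} (a b : (Fin n → Bool) → ℝ) (d : Fin n → Bool) : ℝ :=
  ∑ i, if (if d i then i ∈ maskBiased a d else i ∈ maskBiased b (compl d)) then 1 else 0

theorem badCount_le {n : ℕ} (a b : (Fin n → Bool) → ℝ) (d : Fin n → Bool) :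
    badCount a b d ≤ #(maskBiased a d) + #(maskBiased b (compl d)) := by
  have hcard : ∀ s : Finset (Fin n), (#s : ℝ) = ∑ i, if i ∈ s then (1 : ℝ) else 0 := fun s => by
    simp
  rw [badCount, hcard, hcard, ← sum_add_distrib]
  refine sum_le_sum fun i _ => ?_
  split_ifs <;> norm_num

/-- For most pairs of a division `d` of the coordinates and a coordinate `i`, adding `i` to both
inputs does not change the mass of a rectangle by more than a constant factor. -/
theorem sum_maskSum_mul_le {n : ℕ} {a b : (Fin n → Bool) → ℝ} (ha : ∀ x, 0 ≤ a x)
    (hb : ∀ x, 0 ≤ b x) :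
    2 * ∑ d, maskSum a d * maskSum b (compl d) * (n / 12 - 7 / 12 * badCount a b d) ≤
      ∑ d, ∑ i, fixSum a i true d * fixSum b i true (compl d) := by
  let H : Fin n → (Fin n → Bool) → ℝ := fun i d => maskSum a d * maskSum b (compl d) *
    (1 / 12 - 7 / 12 *
      if (if d i then i ∈ maskBiased a d else i ∈ maskBiased b (compl d)) then 1 else 0)
  have hfa : ∀ i β d, 0 ≤ fixSum a i β d := fun i β d => sum_nonneg fun x _ => ha _
  have hfb : ∀ i β d, 0 ≤ fixSum b i β d := fun i β d => sum_nonneg fun x _ => hb _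
  have hpair : ∀ i d, d i = true →
      H i d + H i (flip i d) ≤ fixSum a i true d * fixSum b i true (compl d) := by
    intro i d hd
    have hd' : flip i d i = false := by simp [hd]
    have hc : compl d i = false := by simp [compl, hd]
    have hc' : flip i (compl d) i = true := by simp [hc]
    have h := mul_le_of_unbiased (hfa i false d) (hfa i true d) (hfb i false (compl d))
      (hfb i true (compl d)) (mem_maskBiased_iff a i d hd)
      (q := i ∈ maskBiased b (flip i (compl d)))
      (by rw [mem_maskBiased_iff b i _ hc', fixSum_flip, fixSum_flip])
    simp only [H, hd, hd', if_true, Bool.false_eq_true, if_false, compl_flip]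
    rw [maskSum_of_true a i d hd, maskSum_of_false b i _ hc, maskSum_of_false a i _ hd',
      maskSum_of_true b i _ hc', fixSum_flip, fixSum_flip, fixSum_flip]
    exact h
  have hpair' : ∀ i d,
      H i d + H i (flip i d) ≤ fixSum a i true d * fixSum b i true (compl d) := by
    intro i d
    cases hd : d i
    · have h := hpair i (flip i d) (by simp [hd])
      rw [flip_flip, compl_flip, fixSum_flip, fixSum_flip] at h
      linarith
    · exact hpair i d hd
  calc 2 * ∑ d, maskSum a d * maskSum b (compl d) * (n / 12 - 7 / 12 * badCount a b d)
      = 2 * ∑ d, ∑ i, H i d := by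
        congr 1
        refine sum_congr rfl fun d _ => ?_
        rw [← mul_sum, sum_sub_distrib, ← mul_sum, badCount, sum_const, nsmul_eq_mul, card_univ,
          Fintype.card_fin, mul_one_div]
    _ = ∑ i, ∑ d, (H i d + H i (flip i d)) := by
        rw [sum_comm, mul_sum]
        refine sum_congr rfl fun i _ => ?_
        rw [sum_add_distrib, Equiv.sum_comp (flip i) (H i), two_mul]
    _ ≤ ∑ i, ∑ d, fixSum a i true d * fixSum b i true (compl d) :=
        sum_le_sum fun i _ => sum_le_sum fun d _ => hpair' i d
    _ = _ := sum_comm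

/-- For each division of the coordinates, either the rectangle is exponentially small or few
coordinates are biased. -/
theorem maskSum_mul_ge {n : ℕ} {a b : (Fin n → Bool) → ℝ}
    (ha : ∀ x, a x ∈ Set.Icc (0 : ℝ) 1) (hb : ∀ x, b x ∈ Set.Icc (0 : ℝ) 1) (d : Fin n → Bool) :
    n / 24 * (maskSum a d * maskSum b (compl d)) - n * (4 ^ n * Real.exp (-(n / 252))) ≤
      maskSum a d * maskSum b (compl d) * (n / 12 - 7 / 12 * badCount a b d) := by
  have h0a : 0 ≤ maskSum a d := sum_nonneg fun x _ => (ha _).1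
  have h0b : 0 ≤ maskSum b (compl d) := sum_nonneg fun x _ => (hb _).1
  have h0 := mul_nonneg h0a h0b
  have hn0 : (0 : ℝ) ≤ n := n.cast_nonneg
  have hE : (0 : ℝ) ≤ 4 ^ n * Real.exp (-(n / 252)) := by positivity
  rcases le_or_gt (badCount a b d) (n / 14) with hbad | hbad
  · nlinarith [mul_le_mul_of_nonneg_left hbad h0, mul_nonneg hn0 hE]
  · have h1 : maskSum a d * maskSum b (compl d) ≤ 4 ^ n * Real.exp (-(n / 252)) := by
      have e1 : maskSum a d ≤ 2 ^ n * Real.exp (-(#(maskBiased a d) / 18)) :=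
        sum_le_exp_card_biased fun x => ha _
      have e2 : maskSum b (compl d) ≤ 2 ^ n * Real.exp (-(#(maskBiased b (compl d)) / 18)) :=
        sum_le_exp_card_biased fun x => hb _
      refine (mul_le_mul e1 e2 h0b (by positivity)).trans ?_
      rw [mul_mul_mul_comm, ← mul_pow, ← Real.exp_add]
      norm_num only
      gcongr
      have := badCount_le a b d
      linarith
    have h2 : badCount a b d ≤ n := by
      refine (sum_le_sum (g := fun _ => (1 : ℝ)) fun i _ => ?_).trans (by simp)
      split_ifs <;> norm_num
    nlinarith [mul_le_mul_of_nonneg_left h2 h0, mul_le_mul_of_nonneg_left h1 hn0]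

/-- The sum of `F` over random disjoint inputs: the coordinates are divided between the two players
and each player has a random subset of the own coordinates. -/
noncomputable def disjSum {n : ℕ} (F : (Fin n → Bool) → (Fin n → Bool) → ℝ) : ℝ :=
  ∑ d, ∑ x, ∑ y, F (mask d x) (mask (compl d) y)

/-- The sum of `F` over random intersecting inputs, which arise from the disjoint inputs of
`disjSum` if one coordinate is added to both. -/
noncomputable def hitSum {n : ℕ} (F : (Fin n → Bool) → (Fin n → Bool) → ℝ) : ℝ :=
  ∑ d, ∑ i, ∑ x, ∑ y,
    F (Function.update (mask d x) i true) (Function.update (mask (compl d) y) i true)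

theorem disjSum_rect {n : ℕ} (a b : (Fin n → Bool) → ℝ) :
    disjSum (fun x y => a x * b y) = ∑ d, maskSum a d * maskSum b (compl d) := by
  simp only [disjSum, maskSum, Fintype.sum_mul_sum]

theorem hitSum_rect {n : ℕ} (a b : (Fin n → Bool) → ℝ) :
    hitSum (fun x y => a x * b y) = ∑ d, ∑ i, fixSum a i true d * fixSum b i true (compl d) := by
  simp only [hitSum, fixSum, Fintype.sum_mul_sum]

theorem disjSum_sum {n : ℕ} {ι : Type*} (s : Finset ι) (w : ι → ℝ)
    (F : ι → (Fin n → Bool) → (Fin n → Bool) → ℝ) :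
    disjSum (fun x y => ∑ k ∈ s, w k * F k x y) = ∑ k ∈ s, w k * disjSum (F k) := by
  simp only [disjSum, mul_sum, sum_comm (t := s)]

theorem hitSum_sum {n : ℕ} {ι : Type*} (s : Finset ι) (w : ι → ℝ)
    (F : ι → (Fin n → Bool) → (Fin n → Bool) → ℝ) :
    hitSum (fun x y => ∑ k ∈ s, w k * F k x y) = ∑ k ∈ s, w k * hitSum (F k) := by
  simp only [hitSum, mul_sum, sum_comm (t := s)]

/-- A rectangle that is not exponentially small among the disjoint inputs contains, up to a constant
factor, as large a part of the intersecting inputs. -/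
theorem hitSum_rect_ge {n : ℕ} {a b : (Fin n → Bool) → ℝ}
    (ha : ∀ x, a x ∈ Set.Icc (0 : ℝ) 1) (hb : ∀ x, b x ∈ Set.Icc (0 : ℝ) 1) :
    n / 12 * disjSum (fun x y => a x * b y) - 2 * n * 8 ^ n * Real.exp (-(n / 252)) ≤
      hitSum fun x y => a x * b y := by
  rw [disjSum_rect, hitSum_rect]
  refine le_trans ?_ (sum_maskSum_mul_le (fun x => (ha x).1) fun x => (hb x).1)
  refine le_trans (le_of_eq ?_)
    (mul_le_mul_of_nonneg_left (sum_le_sum fun d _ => maskSum_mul_ge ha hb d) zero_le_two)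
  rw [sum_sub_distrib, ← mul_sum, sum_const, nsmul_eq_mul, card_univ, Fintype.card_fun,
    Fintype.card_bool, Fintype.card_fin, show (8 : ℝ) = 2 * 4 by norm_num, mul_pow]
  push_cast
  ring

theorem IsRectSum.hitSum_ge {n : ℕ} {m : ℝ} {F : (Fin n → Bool) → (Fin n → Bool) → ℝ}
    (hF : IsRectSum m F) :
    n / 12 * disjSum F - 2 * n * 8 ^ n * Real.exp (-(n / 252)) * m ≤ hitSum F := by
  obtain ⟨ι, _, w, a, b, hw, hs, ha, hb, h⟩ := hF
  obtain rfl : F = fun x y => ∑ k, w k * (a k x * b k y) := by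
    funext x y
    exact h x y
  rw [disjSum_sum, hitSum_sum]
  have h1 := sum_le_sum fun k (_ : k ∈ univ) =>
    mul_le_mul_of_nonneg_left (hitSum_rect_ge (ha k) (hb k)) (hw k)
  refine le_trans ?_ h1
  simp only [mul_sub]
  rw [sum_sub_distrib, ← sum_mul, mul_sum]
  refine sub_le_sub (le_of_eq (sum_congr rfl fun k _ => by ring)) ?_
  rw [mul_comm]
  exact mul_le_mul_of_nonneg_left hs (by positivity)

/-! ### The lower bound for Merlin–Arthur protocols -/

theorem disj_mask {n : ℕ} (d x y : Fin n → Bool) : disj n (mask d x) (mask (compl d) y) = true := by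
  simp only [disj, decide_eq_true_eq]
  intro i
  cases h : d i <;> simp [mask, compl, h]

theorem disj_update_update {n : ℕ} (i : Fin n) (x y : Fin n → Bool) :
    disj n (Function.update x i true) (Function.update y i true) = false := by
  simp only [disj, decide_eq_false_iff_not, not_forall]
  exact ⟨i, by simp⟩

theorem le_disjSum {n : ℕ} {F : (Fin n → Bool) → (Fin n → Bool) → ℝ} {r : ℝ}
    (h : ∀ x y, disj n x y = true → r ≤ F x y) : 8 ^ n * r ≤ disjSum F := by
  have hr : (8 : ℝ) ^ n * r =
      ∑ _d : Fin n → Bool, ∑ _x : Fin n → Bool, ∑ _y : Fin n → Bool, r := by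
    simp only [sum_const, card_univ, Fintype.card_fun, Fintype.card_bool, Fintype.card_fin,
      nsmul_eq_mul]
    rw [show (8 : ℝ) = 2 * (2 * 2) by norm_num, mul_pow, mul_pow]
    push_cast
    ring
  rw [hr]
  exact sum_le_sum fun d _ => sum_le_sum fun x _ => sum_le_sum fun y _ => h _ _ (disj_mask d x y)

theorem hitSum_le {n : ℕ} {F : (Fin n → Bool) → (Fin n → Bool) → ℝ} {r : ℝ}
    (h : ∀ x y, disj n x y = false → F x y ≤ r) : hitSum F ≤ n * 8 ^ n * r := by
  have hr : n * (8 : ℝ) ^ n * r =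
      ∑ _d : Fin n → Bool, ∑ _i : Fin n, ∑ _x : Fin n → Bool, ∑ _y : Fin n → Bool, r := by
    simp only [sum_const, card_univ, Fintype.card_fun, Fintype.card_bool, Fintype.card_fin,
      nsmul_eq_mul]
    rw [show (8 : ℝ) = 2 * (2 * 2) by norm_num, mul_pow, mul_pow]
    push_cast
    ring
  rw [hr]
  exact sum_le_sum fun d _ => sum_le_sum fun i _ => sum_le_sum fun x _ => sum_le_sum fun y _ =>
    h _ _ (disj_update_update i _ _)

/-- Corruption applied to `F x y = ∑_z p_z(x, y) ^ t`, where `p_z` is the acceptance probability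
with guess `z`. The `t`-th powers play the role of `t` independent repetitions. -/
theorem MAProtocol.corruption {n c : ℕ} (hn : 0 < n) (P : MAProtocol (Fin n → Bool) (Fin n → Bool))
    (hP : P.Computes (1 / 4) (disj n)) (hc : P.CostLE c) (t : ℕ) :
    (3 / 4) ^ t / 12 - 2 * Real.exp (-(n / 252)) * (2 ^ P.guessBits * (2 ^ c) ^ t) ≤
      2 ^ P.guessBits * (1 / 4 : ℝ) ^ t := by
  have hnn : ∀ z x y, 0 ≤ P.acceptProb z x y := fun z x y => MeasureTheory.measureReal_nonneg
  have hrect : IsRectSum (2 ^ P.guessBits * (2 ^ c) ^ t)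
      fun x y => ∑ z, P.acceptProb z x y ^ t := by
    have h := IsRectSum.sum univ fun z _ =>
      (P.isRectSum_acceptProb z (c := c) fun ω => le_of_add_le_right (hc z ω)).pow t
    simpa using h
  have h1 : 8 ^ n * (3 / 4 : ℝ) ^ t ≤ disjSum fun x y => ∑ z, P.acceptProb z x y ^ t := by
    refine le_disjSum fun x y hxy => ?_
    obtain ⟨z, hz⟩ := hP.1 x y hxy
    refine le_trans ?_ (single_le_sum (fun z _ => pow_nonneg (hnn z x y) t) (mem_univ z))
    exact pow_le_pow_left₀ (by norm_num) (by linarith) t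
  have h2 : hitSum (fun x y => ∑ z, P.acceptProb z x y ^ t) ≤
      n * 8 ^ n * (2 ^ P.guessBits * (1 / 4 : ℝ) ^ t) := by
    refine hitSum_le fun x y hxy => ?_
    have h : ∀ z ∈ (univ : Finset (Fin P.guessBits → Bool)),
        P.acceptProb z x y ^ t ≤ (1 / 4 : ℝ) ^ t := fun z _ =>
      pow_le_pow_left₀ (hnn z x y) (not_lt.1 fun hz => hP.2 x y hxy ⟨z, hz⟩) t
    refine (sum_le_sum h).trans (le_of_eq ?_)
    simp
  have h3 := hrect.hitSum_ge.trans h2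
  have hn0 : (0 : ℝ) < n := by exact_mod_cast hn
  have h4 := mul_le_mul_of_nonneg_left h1 (by positivity : (0 : ℝ) ≤ n / 12)
  have h5 : (0 : ℝ) < n * 8 ^ n := by positivity
  refine le_of_mul_le_mul_left (le_trans (le_of_eq ?_) ((sub_le_sub_right h4 _).trans h3)) h5
  ring

theorem DetProtocol.eval_eq_of_cost_eq_zero {X Y : Type} {P : DetProtocol X Y} (h : P.cost = 0)
    (x x' : X) (y y' : Y) : P.eval x y = P.eval x' y' := by
  cases P with
  | output b => rfl
  | alice msg next => simp [cost] at h
  | bob msg next => simp [cost] at h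

/-- Without communication and guesses the acceptance probability does not depend on the inputs. -/
theorem MAProtocol.cost_pos {n c : ℕ} (hn : 0 < n) {P : MAProtocol (Fin n → Bool) (Fin n → Bool)}
    (hP : P.Computes (1 / 4) (disj n)) (hc : P.CostLE c) : 0 < c := by
  by_contra h0
  obtain rfl : c = 0 := by omega
  obtain ⟨z, hz⟩ := hP.1 (fun _ => false) (fun _ => false) (by simp [disj])
  refine hP.2 (fun _ => true) (fun _ => true) (by simpa [disj] using ⟨⟨0, hn⟩⟩) ⟨z, ?_⟩
  have h : P.acceptProb z (fun _ => true) (fun _ => true) =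
      P.acceptProb z (fun _ => false) (fun _ => false) := by
    have hω : ∀ ω, (P.run z ω).eval (fun _ => true) (fun _ => true) =
        (P.run z ω).eval (fun _ => false) (fun _ => false) := fun ω =>
      DetProtocol.eval_eq_of_cost_eq_zero (by have := hc z ω; omega) _ _ _ _
    simp only [MAProtocol.acceptProb, hω]
  rw [h]
  linarith

theorem MAProtocol.le_mul_cost_sq {n c : ℕ} (hn : 0 < n)
    {P : MAProtocol (Fin n → Bool) (Fin n → Bool)}
    (hP : P.Computes (1 / 4) (disj n)) (hc : P.CostLE c) : (n : ℝ) ≤ 3780 * (c : ℝ) ^ 2 := by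
  have hpos := cost_pos hn hP hc
  have hk : P.guessBits ≤ c := (Nat.le_add_right _ _).trans (hc (fun _ => false) fun _ => false)
  -- This many repetitions outweigh the `2 ^ P.guessBits` possible guesses
  have hcor := P.corruption hn hP hc (P.guessBits + 4)
  set k := P.guessBits
  set E := Real.exp (-(n / 252 : ℝ)) with hE
  have hE0 : 0 < E := Real.exp_pos _
  have h1 : (3 : ℝ) ^ (k + 4) / 12 - 2 * E * (2 ^ k * (2 ^ c) ^ (k + 4) * 4 ^ (k + 4)) ≤ 2 ^ k := by
    refine le_of_mul_le_mul_right (le_trans (le_of_eq ?_) (hcor.trans (le_of_eq ?_)))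
      (by positivity : (0 : ℝ) < (1 / 4) ^ (k + 4))
    · have e : (4 : ℝ) ^ (k + 4) * (1 / 4) ^ (k + 4) = 1 := by
        rw [← mul_pow]
        norm_num
      rw [div_eq_mul_one_div (3 : ℝ) 4, mul_pow]
      linear_combination (-2 * E * (2 ^ k * (2 ^ c) ^ (k + 4))) * e
    · rfl
  have h2 : (2 : ℝ) ^ k ≤ 3 ^ k := pow_le_pow_left₀ (by norm_num) (by norm_num) k
  have h3 : (1 : ℝ) ≤ E * 2 ^ ((c + 2) * (k + 4)) := by
    have e : (2 : ℝ) ^ ((c + 2) * (k + 4)) = (2 ^ c) ^ (k + 4) * 4 ^ (k + 4) := by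
      rw [pow_mul, ← mul_pow, pow_add 2 c 2]
      norm_num
    rw [e]
    have e3 : (3 : ℝ) ^ (k + 4) = 81 * 3 ^ k := by
      rw [pow_add]
      ring
    rw [e3, mul_assoc (2 ^ k)] at h1
    have h2k : (0 : ℝ) < 2 ^ k := by positivity
    generalize (2 : ℝ) ^ k = A at h1 h2 h2k
    generalize (2 ^ c : ℝ) ^ (k + 4) * 4 ^ (k + 4) = B at h1
    refine le_of_mul_le_mul_left ?_ h2k
    linarith
  have h5 : (c + 2) * (k + 4) ≤ 15 * c ^ 2 := by
    have : (c + 2) * (k + 4) ≤ (3 * c) * (5 * c) := Nat.mul_le_mul (by omega) (by omega)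
    linarith
  have h6 : (2 : ℝ) ^ ((c + 2) * (k + 4)) ≤ Real.exp (15 * (c : ℝ) ^ 2) := by
    refine (pow_le_pow_right₀ (by norm_num) h5).trans ?_
    have e2 : (2 : ℝ) ≤ Real.exp 1 := by
      have := Real.add_one_le_exp 1
      linarith
    refine (pow_le_pow_left₀ (by norm_num) e2 _).trans (le_of_eq ?_)
    rw [← Real.exp_nat_mul]
    push_cast
    ring_nf
  have h7 : 1 ≤ Real.exp (-(n / 252 : ℝ) + 15 * (c : ℝ) ^ 2) := by
    rw [Real.exp_add]
    exact h3.trans (mul_le_mul_of_nonneg_left h6 hE0.le)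
  rw [Real.one_le_exp_iff] at h7
  linarith

theorem sqrt_le_maComplexity_disj (n : ℕ) :
    1 / 62 * Real.sqrt n ≤ (maComplexity (disj n) : ℝ) := by
  rcases Nat.eq_zero_or_pos n with rfl | hn
  · simp
  obtain ⟨P, hP, hc⟩ := Nat.sInf_mem
    (maComplexityWithError_set_nonempty (ε := 1 / 4) (by norm_num) (disj n))
  have h := MAProtocol.le_mul_cost_sq hn hP hc
  change (n : ℝ) ≤ 3780 * (maComplexity (disj n) : ℝ) ^ 2 at h
  have h1 : Real.sqrt n ≤ 62 * (maComplexity (disj n) : ℝ) := by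
    refine Real.sqrt_le_iff.2 ⟨by positivity, h.trans ?_⟩
    nlinarith [sq_nonneg (maComplexity (disj n) : ℝ)]
  linarith

/-! ### The nondeterministic upper bound -/

namespace DetProtocol

variable {X Y : Type}

/-- Alice sends `k` bits, computed by `g` from her input, and then the protocol chosen by these bits
is run. -/
def sendBits : (k : ℕ) → (X → Fin k → Bool) → ((Fin k → Bool) → DetProtocol X Y) → DetProtocol X Y
  | 0, _, next => next Fin.elim0
  | k + 1, g, next =>
    alice (fun x => g x 0) fun β =>
      sendBits k (fun x => Fin.tail (g x)) fun v => next (Fin.cons β v)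

theorem eval_sendBits (k : ℕ) (g : X → Fin k → Bool) (next : (Fin k → Bool) → DetProtocol X Y)
    (x : X) (y : Y) : (sendBits k g next).eval x y = (next (g x)).eval x y := by
  induction k with
  | zero => rw [sendBits, Subsingleton.elim (g x) Fin.elim0]
  | succ k ih => rw [sendBits, eval, ih, Fin.cons_self_tail]

theorem cost_sendBits_le (k : ℕ) (g : X → Fin k → Bool) (next : (Fin k → Bool) → DetProtocol X Y)
    {c : ℕ} (hc : ∀ v, (next v).cost ≤ c) : (sendBits k g next).cost ≤ k + c := by
  induction k with
  | zero => simpa [sendBits] using hc _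
  | succ k ih =>
    have h := Nat.add_le_add_left (max_le (ih (fun x => Fin.tail (g x))
      (fun v => next (Fin.cons false v)) fun v => hc _) (ih (fun x => Fin.tail (g x))
      (fun v => next (Fin.cons true v)) fun v => hc _)) 1
    rw [sendBits, cost]
    omega

end DetProtocol

/-- Alice guesses an index `i` and sends it; the players accept if `xᵢ = yᵢ = 1`. -/
theorem nondetComplexity_not_disj_le {n k : ℕ} (hn : 0 < n) (hk : n ≤ 2 ^ k) :
    nondetComplexity (fun x y => !disj n x y) ≤ k + 2 := by
  have : Nonempty (Fin n) := ⟨⟨0, hn⟩⟩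
  obtain ⟨f⟩ : Nonempty (Fin n ↪ (Fin k → Bool)) :=
    Function.Embedding.nonempty_of_card_le (by simpa using hk)
  let idx : (Fin k → Bool) → Fin n := Function.invFun f
  have hidx : ∀ i, idx (f i) = i := Function.leftInverse_invFun f.injective
  let next : (Fin k → Bool) →
      DetProtocol ((Fin n → Bool) × (Fin k → Bool)) ((Fin n → Bool) × (Fin 0 → Bool)) := fun v =>
    .alice (fun p => p.1 (idx v)) fun α => .bob (fun q => q.1 (idx v)) fun β => .output (α && β)
  let P : NondetProtocol (Fin n → Bool) (Fin n → Bool) := ⟨k, 0, .sendBits k Prod.snd next⟩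
  have hP : P.Computes fun x y => !disj n x y := by
    intro x y
    have h1 : P.Accepts x y ↔ ∃ u : Fin k → Bool, x (idx u) = true ∧ y (idx u) = true := by
      simp [NondetProtocol.Accepts, P, DetProtocol.eval_sendBits, next, DetProtocol.eval]
    rw [h1]
    constructor
    · rintro ⟨u, hx, hy⟩
      simpa [disj] using ⟨idx u, hx, hy⟩
    · intro h
      obtain ⟨i, hx, hy⟩ : ∃ i, x i = true ∧ y i = true := by simpa [disj] using h
      exact ⟨f i, by rwa [hidx], by rwa [hidx]⟩
  have hle : nondetComplexity (fun x y => !disj n x y) ≤ P.cost := Nat.sInf_le ⟨P, hP, rfl⟩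
  refine hle.trans ?_
  exact DetProtocol.cost_sendBits_le k _ next fun v => by simp [next, DetProtocol.cost]

theorem nondetComplexity_not_disj_le_log {n : ℕ} (hn : 2 ≤ n) :
    (nondetComplexity (fun x y => !disj n x y) : ℝ) ≤ 4 / Real.log 2 * Real.log n := by
  have h1 := nondetComplexity_not_disj_le (k := Nat.log 2 n + 1) (by omega)
    (Nat.lt_pow_succ_log_self (by norm_num) n).le
  have h2 : (nondetComplexity (fun x y => !disj n x y) : ℝ) ≤ Nat.log 2 n + 3 := by
    exact_mod_cast h1
  have h3 : (Nat.log 2 n : ℝ) ≤ Real.log n / Real.log 2 := by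
    have := Real.natLog_le_logb n 2
    simpa [Real.logb] using this
  have hl : 0 < Real.log 2 := Real.log_pos (by norm_num)
  have h4 : 1 ≤ Real.log n / Real.log 2 := by
    rw [le_div_iff₀ hl, one_mul]
    exact Real.log_le_log (by norm_num) (by exact_mod_cast hn)
  calc _ ≤ (Nat.log 2 n : ℝ) + 3 := h2
    _ ≤ 4 * (Real.log n / Real.log 2) := by linarith
    _ = _ := by ring

end CommComplexity

theorem mainTheorem3 :
    (∃ c : ℝ, 0 < c ∧ ∀ n : ℕ,
      c * Real.sqrt (n : ℝ) ≤ (CommComplexity.maComplexity (CommComplexity.disj n) : ℝ)) ∧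
    (∃ C : ℝ, 0 < C ∧ ∀ n : ℕ, 2 ≤ n →
      (CommComplexity.nondetComplexity (fun x y => !CommComplexity.disj n x y) : ℝ)
        ≤ C * Real.log (n : ℝ)) :=
  ⟨⟨1 / 62, by norm_num, CommComplexity.sqrt_le_maComplexity_disj⟩,
    ⟨4 / Real.log 2, div_pos (by norm_num) (Real.log_pos (by norm_num)),
      fun _ hn => CommComplexity.nondetComplexity_not_disj_le_log hn⟩⟩
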